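/- Let $k\ge 2$. The infinite looped $k$-ary tree is the rooted tree in which every vertex has $k$ children, ordered from left to right, with a self-loop added at the root (so that the root is regarded as its own parent). Finitely many chips with distinct labels $1,2,\dots,N$ lie on the vertices. A vertex $v$ carrying at least $k+1$ chips can \emph{fire}: one chooses $k+1$ chips on $v$, sends the $\lceil\frac{k+1}{2}\rceil$-th smallest of them to the parent of $v$, and, for each $j\in\{1,\dots,k\}$, sends the $j$-th smallest of the remaining $k$ chosen chips to the $j$-th leftmost child of $v$. A configuration is \emph{stable} if no vertex can fire. For $\ell\ge 1$ put $N_{k,\ell}=\frac{k^\ell-1}{k-1}$, and let $Z_{k,\ell}$ be the number of distinct stable configurations that can be reached by successive firings from the configuration in which the chips $1,2,\dots,N_{k,\ell}$ all lie on the root. Then for all integers $k\ge 2$ and $\ell\ge 3$, $$Z_{k,\ell}\;\ge\;\sum_{i=0}^{\lfloor k/2\rfloor}\binom{a}{i}\binom{b+i}{i}\,Z_{k,\ell-1}^{\,k},$$ where $a=(N_{k,\ell}-1)\cdot\frac{\lfloor k/2\rfloor}{k}-1-\lfloor k/2\rfloor$ and $b=(N_{k,\ell}-1)\cdot\frac{\lceil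 k/2\rceil}{k}-1-2\lceil k/2\rceil$ (both are nonnegative integers). -/

import Mathlib

namespace ChipFiring

/-- Vertices of the infinite rooted `k`-ary tree, as addresses: the root is `[]`, and `j :: v` is
the `j`-th child of `v`, counted from the left, starting with `0`. -/
abbrev Vertex (k : ℕ) : Type := List (Fin k)

/-- The `j`-th leftmost child of `v`. -/
def child {k : ℕ} (v : Vertex k) (j : Fin k) : Vertex k := j :: v

/-- The parent of `v`. The root carries a self-loop, so it counts as its own parent. -/
def parent {k : ℕ} : Vertex k → Vertex k
  | [] => []
  | _ :: v => v

/-- A configuration of `n` labeled chips: the vertex on which each chip lies. The chip with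
label `i + 1` is `i : Fin n`. -/
abbrev Config (k n : ℕ) : Type := Fin n → Vertex k

/-- The position (starting with `0`) of the chip that goes to the parent, among the `k + 1` fired
chips in increasing order. -/
def parentRank (k : ℕ) : Fin (k + 1) := ⟨k / 2, by omega⟩

/-- Counted from `1`, that position is `⌈(k + 1) / 2⌉`. -/
theorem parentRank_add_one (k : ℕ) : (parentRank k : ℕ) + 1 = (k + 1) ⌈/⌉ 2 := by
  simp only [parentRank, Nat.ceilDiv_eq_add_pred_div]
  omega

/-- `c'` arises from `c` by firing, at the vertex `v`, the chips `s 0 < s 1 < ⋯ < s k`, all of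
which lie on `v`: the `⌈(k + 1) / 2⌉`-th smallest of them goes to the parent of `v`, the `j`-th
smallest of the other `k` goes to the `j`-th leftmost child of `v`, and no other chip moves.
(`(parentRank k).succAbove` lists the positions other than `parentRank k` in increasing order.) -/
structure FiresTo {k n : ℕ} (v : Vertex k) (s : Fin (k + 1) ↪o Fin n) (c c' : Config k n) :
    Prop where
  on_vertex : ∀ r, c (s r) = v
  to_parent : c' (s (parentRank k)) = parent v
  to_child : ∀ j : Fin k, c' (s ((parentRank k).succAbove j)) = child v j
  unmoved : ∀ x, x ∉ Set.range s → c' x = c x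

/-- A single firing move. -/
def Step {k n : ℕ} (c c' : Config k n) : Prop :=
  ∃ (v : Vertex k) (s : Fin (k + 1) ↪o Fin n), FiresTo v s c c'

/-- A vertex can fire when at least `k + 1` chips lie on it. -/
def CanFire {k n : ℕ} (c : Config k n) (v : Vertex k) : Prop :=
  k + 1 ≤ (Finset.univ.filter fun x => c x = v).card

/-- A configuration is stable when no vertex can fire. -/
def IsStable {k n : ℕ} (c : Config k n) : Prop := ∀ v, ¬ CanFire c v

/-- All chips lie on the root. -/
def initial (k n : ℕ) : Config k n := fun _ => []

/-- The stable configurations reachable by firing from `n` labeled chips on the root. -/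
def stableConfigs (k n : ℕ) : Set (Config k n) :=
  {c | Relation.ReflTransGen Step (initial k n) c ∧ IsStable c}

/-- The number of chips `N_{k,ℓ} = (k ^ ℓ - 1) / (k - 1)`; the division is exact for `k ≥ 2`. -/
def numChips (k l : ℕ) : ℕ := (k ^ l - 1) / (k - 1)

/-- `Z_{k,ℓ}`: the number of stable configurations reachable from `N_{k,ℓ}` labeled chips on the
root. -/
noncomputable def Z (k l : ℕ) : ℕ := (stableConfigs k (numChips k l)).ncard

/-- The number `(N_{k,ℓ} - 1) * ⌊k/2⌋ / k - 1 - ⌊k/2⌋`. -/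
def lowerA (k l : ℕ) : ℕ := (numChips k l - 1) * (k / 2) / k - 1 - k / 2

/-- The number `(N_{k,ℓ} - 1) * ⌈k/2⌉ / k - 1 - 2 * ⌈k/2⌉`. -/
def lowerB (k l : ℕ) : ℕ := (numChips k l - 1) * (k ⌈/⌉ 2) / k - 1 - 2 * (k ⌈/⌉ 2)

theorem numChips_succ {k : ℕ} (hk : 2 ≤ k) (l : ℕ) :
    numChips k (l + 1) = k * numChips k l + 1 := by
  have h (n : ℕ) : numChips k n = ∑ i ∈ Finset.range n, k ^ i := (Nat.geomSum_eq hk n).symm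
  rw [h, h, Finset.sum_range_succ', Finset.mul_sum]
  simp [pow_succ, mul_comm]

theorem lt_numChips {k l : ℕ} (hk : 2 ≤ k) (hl : 2 ≤ l) : k < numChips k l := by
  obtain ⟨m, rfl⟩ := Nat.exists_eq_add_of_le' hl
  rw [show m + 2 = m + 1 + 1 from rfl, numChips_succ hk, numChips_succ hk]
  nlinarith [Nat.zero_le (k * numChips k m)]

/-- In the range that matters, nothing is truncated in `lowerA`. -/
theorem lowerA_cast {k l : ℕ} (hk : 2 ≤ k) (hl : 3 ≤ l) :
    (lowerA k l : ℚ) =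
      ((numChips k l : ℚ) - 1) * ((k / 2 : ℕ) : ℚ) / k - 1 - ((k / 2 : ℕ) : ℚ) := by
  obtain ⟨m, rfl⟩ := Nat.exists_eq_add_of_le' (show 1 ≤ l by omega)
  have hM := lt_numChips hk (show 2 ≤ m by omega)
  have hq : 1 ≤ k / 2 := by omega
  have hk0 : (k : ℚ) ≠ 0 := by positivity
  have hle : 1 + k / 2 ≤ numChips k m * (k / 2) := by nlinarith
  rw [lowerA, numChips_succ hk, Nat.add_sub_cancel, mul_assoc,
    Nat.mul_div_cancel_left _ (by omega), Nat.sub_sub, Nat.cast_sub hle]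
  push_cast
  field_simp
  ring

/-- In the range that matters, nothing is truncated in `lowerB`. -/
theorem lowerB_cast {k l : ℕ} (hk : 2 ≤ k) (hl : 3 ≤ l) :
    (lowerB k l : ℚ) =
      ((numChips k l : ℚ) - 1) * ((k ⌈/⌉ 2 : ℕ) : ℚ) / k - 1 - 2 * ((k ⌈/⌉ 2 : ℕ) : ℚ) := by
  obtain ⟨m, rfl⟩ := Nat.exists_eq_add_of_le' (show 1 ≤ l by omega)
  have hM := lt_numChips hk (show 2 ≤ m by omega)
  have hq : 1 ≤ k ⌈/⌉ 2 := by rw [Nat.ceilDiv_eq_add_pred_div]; omega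
  have hk0 : (k : ℚ) ≠ 0 := by positivity
  have hle : 1 + 2 * (k ⌈/⌉ 2) ≤ numChips k m * (k ⌈/⌉ 2) := by nlinarith
  rw [lowerB, numChips_succ hk, Nat.add_sub_cancel, mul_assoc,
    Nat.mul_div_cancel_left _ (by omega), Nat.sub_sub, Nat.cast_sub hle]
  push_cast
  field_simp
  ring

end ChipFiring

/-! ### Firing counts, the least action principle and finiteness. -/

namespace ChipFiring

open Relation

variable {k n : ℕ}

/-! Put `m = N_{k,ℓ-1}`, `p = ⌊k/2⌋`, `q = ⌈k/2⌉`, so that there are `k * m + 1` chips. Suppose the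
root has sent a block of `m` chips to each child and kept one chip. The `k` subtrees can then run
separate copies of the process with `m` chips, except that each copy needs a loop at its own root.
The loop is simulated: when every child has fired, the root holds `k` returned chips and the kept
one, and firing them sends each returned chip back where it came from, provided that they are in the
right order. By the least action principle all copies fire their roots equally often, so these
firings can be synchronized (`reachable_combine`), and any `k` stable outcomes combine into one.

A returned chip is never the first or last of its block, so the order condition `Central` leaves
these extreme chips free. This allows `i` chips `X` below the kept chip `m * p` (counting from `0`)
to lie in right blocks, and `i` chips `Y` above it in left blocks (`nonempty_pattern`,
`Pattern.exists_layout`). The pair can be read off the final configuration, so distinct pairs give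
distinct results. There are `C(m*p - p - 1, i) * C(m*q - q - 1, i)` pairs for each `i ≤ p`; here `a
= m*p - p - 1` and `b + i ≤ m*q - q - 1`. -/

/-- `Fired L c`: the configuration `c` arises from the initial one by firing the vertices of `L`,
the last one first in the list. -/
inductive Fired {k n : ℕ} : List (Vertex k) → Config k n → Prop
  | nil : Fired [] (initial k n)
  | cons {L : List (Vertex k)} {c c' : Config k n} {v : Vertex k} {s : Fin (k + 1) ↪o Fin n} :
      Fired L c → FiresTo v s c c' → Fired (v :: L) c'

theorem exists_fired {c : Config k n} (h : ReflTransGen Step (initial k n) c) :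
    ∃ L, Fired L c := by
  induction h with
  | refl => exact ⟨_, .nil⟩
  | tail _ hs ih =>
    obtain ⟨L, hL⟩ := ih
    obtain ⟨v, s, hf⟩ := hs
    exact ⟨_, hL.cons hf⟩

/-- The number of chips on a vertex. -/
def load (c : Config k n) (v : Vertex k) : ℕ := ∑ x, if c x = v then 1 else 0

theorem load_eq_card (c : Config k n) (v : Vertex k) :
    load c v = (Finset.univ.filter fun x => c x = v).card := by
  simp [load]

/-- Adjacency in the looped tree is symmetric; the loop enters because the root is its own parent on
both sides. -/
theorem indicator_neighbors (u v : Vertex k) :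
    ((if parent u = v then 1 else 0) + ∑ j, if child u j = v then 1 else 0 : ℕ) =
      (if u = parent v then 1 else 0) + ∑ j, if u = child v j then 1 else 0 := by
  rcases u with _ | ⟨i, u⟩ <;> rcases v with _ | ⟨j, v⟩
  · simp [parent, child]
  · by_cases h : v = []
    · subst h; simp [parent, child]
    · simp [parent, child, Ne.symm h]
  · by_cases h : u = []
    · subst h; simp [parent, child]
    · simp [parent, child, h]
  · by_cases h2 : u = j :: v
    · subst h2
      by_cases h3 : i :: j :: v = v
      · have := congrArg List.length h3
        simp only [List.length_cons] at this
        omega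
      · simp [parent, child, h3]
    · by_cases h3 : i :: u = v
      · subst h3; simp [parent, child, h2]
      · simp [parent, child, h2, h3]

theorem FiresTo.load_add {v : Vertex k} {s : Fin (k + 1) ↪o Fin n} {c c' : Config k n}
    (h : FiresTo v s c c') (w : Vertex k) :
    load c' w + (k + 1) * (if v = w then 1 else 0) =
      load c w + ((if v = parent w then 1 else 0) + ∑ j, if v = child w j then 1 else 0) := by
  classical
  have split (d : Config k n) : load d w =
      (∑ r, if d (s r) = w then 1 else 0) +
        ∑ x ∈ (Finset.univ.image s)ᶜ, if d x = w then 1 else 0 := by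
    rw [load, ← Finset.sum_add_sum_compl (Finset.univ.image s),
      Finset.sum_image s.injective.injOn]
  have hc : (∑ x ∈ (Finset.univ.image s)ᶜ, if c' x = w then 1 else 0) =
      ∑ x ∈ (Finset.univ.image s)ᶜ, if c x = w then 1 else 0 := by
    refine Finset.sum_congr rfl fun x hx => ?_
    rw [h.unmoved x (by simpa using hx)]
  rw [split c', split c, hc, ← indicator_neighbors, Fin.sum_univ_succAbove _ (parentRank k)]
  simp only [h.to_parent, h.to_child, h.on_vertex, Finset.sum_const, Finset.card_univ,
    Fintype.card_fin, smul_eq_mul]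
  ring

/-- The loads depend only on how often each vertex fired, through the Laplacian of the looped tree.
-/
theorem Fired.load_add {L : List (Vertex k)} {c : Config k n} (h : Fired L c) (w : Vertex k) :
    load c w + (k + 1) * L.count w =
      load (initial k n) w + (L.count (parent w) + ∑ j, L.count (child w j)) := by
  induction h with
  | nil => simp
  | @cons L c c' v s _ hf ih =>
    have := hf.load_add w
    simp only [List.count_cons, beq_iff_eq, mul_add, Finset.sum_add_distrib]
    omega

theorem FiresTo.le_load {v : Vertex k} {s : Fin (k + 1) ↪o Fin n} {c c' : Config k n}
    (h : FiresTo v s c c') : k + 1 ≤ load c v := by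
  rw [load_eq_card]
  calc k + 1 = (Finset.univ.map s.toEmbedding).card := by simp
    _ ≤ _ := Finset.card_le_card fun x hx => by
      obtain ⟨r, -, rfl⟩ := Finset.mem_map.1 hx
      simpa using h.on_vertex r

/-- The least action principle: a firing sequence fires no vertex more often than a stabilizing
one does. -/
theorem Fired.count_le {L L' : List (Vertex k)} {c c' : Config k n} (h : Fired L c)
    (h' : Fired L' c') (hs : IsStable c') (v : Vertex k) : L.count v ≤ L'.count v := by
  induction h generalizing v with
  | nil => simp
  | @cons L c d u s hL hf ih =>
    by_cases hvu : u = v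
    · subst hvu
      rw [List.count_cons_self, Nat.succ_le_iff]
      -- If `u` had already fired as often as in `L'`, while its neighbors fired at most as often,
      -- then `c'` would have at least as many chips on `u` as `c`, enough to fire.
      refine lt_of_le_of_ne (ih u) fun heq => hs u ?_
      have h1 := hL.load_add u
      have h2 := h'.load_add u
      have h3 := ih (parent u)
      have h4 : ∑ j, L.count (child u j) ≤ ∑ j, L'.count (child u j) :=
        Finset.sum_le_sum fun j _ => ih _
      have h5 := hf.le_load
      rw [heq] at h1
      rw [CanFire, ← load_eq_card]
      omega
    · rw [List.count_cons_of_ne hvu]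
      exact ih v

theorem Fired.count_eq {L L' : List (Vertex k)} {c c' : Config k n} (h : Fired L c)
    (h' : Fired L' c') (hs : IsStable c) (hs' : IsStable c') (v : Vertex k) :
    L.count v = L'.count v :=
  le_antisymm (h.count_le h' hs' v) (h'.count_le h hs v)

theorem FiresTo.eq_or {v : Vertex k} {s : Fin (k + 1) ↪o Fin n} {c c' : Config k n}
    (h : FiresTo v s c c') (x : Fin n) :
    c x = v ∧ (c' x = parent v ∨ ∃ j, c' x = child v j) ∨ c' x = c x := by
  by_cases hx : x ∈ Set.range s
  · obtain ⟨r, rfl⟩ := hx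
    refine .inl ⟨h.on_vertex r, ?_⟩
    rcases Fin.eq_self_or_eq_succAbove (parentRank k) r with rfl | ⟨j, rfl⟩
    · exact .inl h.to_parent
    · exact .inr ⟨j, h.to_child j⟩
  · exact .inr (h.unmoved x hx)

theorem Fired.parent_mem {L : List (Vertex k)} {c : Config k n} (h : Fired L c) :
    (∀ v ∈ L, v = [] ∨ parent v ∈ L) ∧ ∀ x, c x = [] ∨ parent (c x) ∈ L := by
  induction h with
  | nil => exact ⟨by simp, fun x => .inl rfl⟩
  | @cons L c c' v s _ hf ih =>
    obtain ⟨ih1, ih2⟩ := ih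
    have hv : v = [] ∨ parent v ∈ L := by
      have := ih2 (s 0)
      rwa [hf.on_vertex] at this
    refine ⟨fun w hw => ?_, fun x => ?_⟩
    · rcases List.mem_cons.1 hw with rfl | hw
      · exact hv.imp_right (List.mem_cons_of_mem _)
      · exact (ih1 w hw).imp_right (List.mem_cons_of_mem _)
    · rcases hf.eq_or x with ⟨_, h | ⟨j, h⟩⟩ | h
      · rw [h]
        rcases hv with rfl | hv
        · exact .inl rfl
        · exact (ih1 _ hv).imp_right (List.mem_cons_of_mem _)
      · rw [h]
        exact .inr (by simp [child, parent])
      · rw [h]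
        exact (ih2 x).imp_right (List.mem_cons_of_mem _)

/-- An infinite set has `ncard` equal to `0`, so finiteness is indispensable. A chip off the root
lies on a child of a fired vertex, and the least action principle confines the fired vertices to
those of one stabilizing sequence. -/
theorem finite_stableConfigs (k n : ℕ) : (stableConfigs k n).Finite := by
  classical
  rcases (stableConfigs k n).eq_empty_or_nonempty with h | ⟨c₀, h₀, hs₀⟩
  · simp [h]
  obtain ⟨L₀, hL₀⟩ := exists_fired h₀
  let T : Finset (Vertex k) :=
    insert [] (L₀.toFinset.biUnion fun v => Finset.univ.image fun j => child v j)
  refine (Set.Finite.pi' (t := fun _ : Fin n => (T : Set (Vertex k)))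
    fun _ => T.finite_toSet).subset ?_
  rintro c ⟨hc, hs⟩ x
  obtain ⟨L, hL⟩ := exists_fired hc
  rcases hcx : c x with _ | ⟨j, v⟩
  · simp [T]
  · have h1 : v ∈ L := by
      have := hL.parent_mem.2 x
      simpa [hcx, parent] using this
    have h2 : v ∈ L₀ := by
      rw [← List.count_pos_iff] at h1 ⊢
      exact h1.trans_le (hL.count_le hL₀ hs₀ v)
    simp only [T, Finset.coe_insert, Finset.coe_biUnion, Set.mem_insert_iff]
    right
    simp only [Set.mem_iUnion]
    exact ⟨v, by simpa using h2, by simp [child]⟩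

/-- Firing some vertex other than the root. -/
def InnerStep (c c' : Config k n) : Prop :=
  ∃ (v : Vertex k) (s : Fin (k + 1) ↪o Fin n), v ≠ [] ∧ FiresTo v s c c'

theorem Fired.inner_of_count_eq_zero {L : List (Vertex k)} {c : Config k n} (h : Fired L c)
    (h0 : L.count [] = 0) : ReflTransGen InnerStep (initial k n) c := by
  induction h with
  | nil => exact .refl
  | @cons L c c' v s _ hf ih =>
    rw [List.count_eq_zero, List.mem_cons, not_or] at h0
    exact (ih (List.count_eq_zero.2 h0.2)).tail ⟨v, s, Ne.symm h0.1, hf⟩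

/-- Cutting at the last root firing leaves only inner moves after it; this drives the induction in
`reachable_combine`. -/
theorem Fired.exists_last_root {L : List (Vertex k)} {c : Config k n} (h : Fired L c) {m : ℕ}
    (hm : L.count [] = m + 1) : ∃ (L' : List (Vertex k)) (d d' : Config k n)
      (s : Fin (k + 1) ↪o Fin n), Fired L' d ∧ L'.count [] = m ∧ FiresTo [] s d d' ∧
        ReflTransGen InnerStep d' c := by
  induction h with
  | nil => simp at hm
  | @cons L c c' v s hL hf ih =>
    by_cases hv : v = []
    · subst hv
      rw [List.count_cons_self] at hm
      exact ⟨L, c, c', s, hL, by omega, hf, .refl⟩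
    · rw [List.count_cons_of_ne hv] at hm
      obtain ⟨L', d, d', s', h1, h2, h3, h4⟩ := ih hm
      exact ⟨L', d, d', s', h1, h2, h3, h4.tail ⟨v, s, hv, hf⟩⟩

end ChipFiring

/-! ### Layouts, and the simulation of `k` smaller processes in the subtrees. -/

namespace ChipFiring

open Relation

variable {k m n : ℕ}

/-- A partition of `n` chips into `k` blocks of `m` chips each, listed in increasing order,
and one further chip. -/
structure Layout (k m n : ℕ) where
  /-- The chips of each block. -/
  block : Fin k → Fin m ↪o Fin n
  /-- The chip outside the blocks. -/
  rest : Fin n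
  bijective : Function.Bijective fun o : Option (Fin k × Fin m) =>
    o.elim rest fun y => block y.1 y.2

namespace Layout

variable (Λ : Layout k m n)

theorem forall_iff {P : Fin n → Prop} : (∀ x, P x) ↔ P Λ.rest ∧ ∀ j t, P (Λ.block j t) := by
  refine ⟨fun h => ⟨h _, fun _ _ => h _⟩, fun ⟨h1, h2⟩ x => ?_⟩
  obtain ⟨_ | ⟨j, t⟩, rfl⟩ := Λ.bijective.2 x
  · exact h1
  · exact h2 j t

theorem block_ne_rest (j : Fin k) (t : Fin m) : Λ.block j t ≠ Λ.rest := fun h => by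
  have := @Λ.bijective.1 (some (j, t)) none h
  simp at this

/-- The configuration with prescribed places for the chips of the blocks, the remaining chip being
on the root. -/
noncomputable def place (a : Fin k → Fin m → Vertex k) : Config k n := fun x =>
  ((Equiv.ofBijective _ Λ.bijective).symm x).elim [] fun y => a y.1 y.2

@[simp] theorem place_rest (a : Fin k → Fin m → Vertex k) : Λ.place a Λ.rest = [] := by
  have : (Equiv.ofBijective _ Λ.bijective).symm Λ.rest = none := by
    rw [Equiv.symm_apply_eq]; rfl
  simp [place, this]

@[simp] theorem place_block (a : Fin k → Fin m → Vertex k) (j : Fin k) (t : Fin m) :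
    Λ.place a (Λ.block j t) = a j t := by
  have : (Equiv.ofBijective _ Λ.bijective).symm (Λ.block j t) = some (j, t) := by
    rw [Equiv.symm_apply_eq]; rfl
  simp [place, this]

/-- The configuration in which the `j`-th block forms the configuration `c j` in the subtree of
the `j`-th child of the root. -/
noncomputable def combine (c : Fin k → Config k m) : Config k n :=
  Λ.place fun j t => c j t ++ [j]

theorem combine_injective : Function.Injective Λ.combine := by
  intro c d h
  ext1 j
  ext1 t
  have := congrFun h (Λ.block j t)
  simpa [combine] using this

theorem isStable_combine {c : Fin k → Config k m} (hk : 1 ≤ k) (h : ∀ j, IsStable (c j)) :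
    IsStable (Λ.combine c) := by
  intro v hv
  rcases List.eq_nil_or_concat' v with rfl | ⟨w, j, rfl⟩
  · have key : ∀ x, Λ.combine c x = [] → x = Λ.rest := by
      rw [Λ.forall_iff]
      simp [combine]
    have := Finset.card_le_card (fun x hx => Finset.mem_singleton.2 (key x (by simpa using hx)) :
      (Finset.univ.filter fun x => Λ.combine c x = []) ⊆ {Λ.rest})
    rw [CanFire] at hv
    simp only [Finset.card_singleton] at this
    omega
  · have key : ∀ x, Λ.combine c x = w ++ [j] → ∃ t, c j t = w ∧ Λ.block j t = x := by
      rw [Λ.forall_iff]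
      refine ⟨by simp [combine], fun i t hx => ?_⟩
      rw [combine, place_block] at hx
      obtain ⟨h1, h2⟩ := List.append_inj' hx rfl
      obtain rfl : i = j := by simpa using h2
      exact ⟨t, h1, rfl⟩
    refine h j w (le_trans hv ?_)
    rw [← Finset.card_map (Λ.block j).toEmbedding]
    refine Finset.card_le_card fun x hx => ?_
    obtain ⟨t, ht, rfl⟩ := key x (by simpa using hx)
    exact Finset.mem_map.2 ⟨t, by simpa using ht, rfl⟩

/-- Blocks are listed increasingly, so ranks among fired chips survive the embedding. Arbitrary
places are allowed because chips of a block may be waiting on the root. -/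
theorem firesTo_block {a a' : Fin k → Fin m → Vertex k} (j : Fin k) {v : Vertex k}
    (s : Fin (k + 1) ↪o Fin m) (h : ∀ r, a j (s r) = v)
    (hp : a' j (s (parentRank k)) = parent v)
    (hc : ∀ i, a' j (s ((parentRank k).succAbove i)) = child v i)
    (hu : ∀ t, t ∉ Set.range s → a' j t = a j t) (hj : ∀ i, i ≠ j → a' i = a i) :
    FiresTo v (s.trans (Λ.block j)) (Λ.place a) (Λ.place a') where
  on_vertex r := by simp [h]
  to_parent := by simp [hp]
  to_child i := by simp [hc]
  unmoved := by
    rw [Λ.forall_iff]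
    refine ⟨by simp, fun i t ht => ?_⟩
    rw [place_block, place_block]
    by_cases hij : i = j
    · subst hij
      refine hu t fun ⟨r, hr⟩ => ht ⟨r, ?_⟩
      simp [hr]
    · rw [hj i hij]

theorem parent_append {v : Vertex k} (hv : v ≠ []) (w : Vertex k) :
    parent (v ++ w) = parent v ++ w := by
  cases v <;> simp_all [parent]

/-- Taking parents commutes with passing to a subtree only away from the subtree's root, hence the
restriction to inner moves. -/
theorem step_combine_update {c : Fin k → Config k m} (j : Fin k) {d : Config k m}
    (h : InnerStep (c j) d) : Step (Λ.combine c) (Λ.combine (Function.update c j d)) := by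
  obtain ⟨v, s, hv, hf⟩ := h
  refine ⟨v ++ [j], _, Λ.firesTo_block j s (fun r => ?_) ?_ (fun i => ?_) (fun t ht => ?_)
    (fun i hi => ?_)⟩
  · rw [hf.on_vertex]
  · rw [Function.update_self, hf.to_parent, parent_append hv]
  · rw [Function.update_self, hf.to_child]; rfl
  · rw [Function.update_self, hf.unmoved t ht]
  · rw [Function.update_of_ne hi]

theorem reachable_combine_update (c : Fin k → Config k m) (j : Fin k) {d : Config k m}
    (h : ReflTransGen InnerStep (c j) d) :
    ReflTransGen Step (Λ.combine c) (Λ.combine (Function.update c j d)) := by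
  induction h with
  | refl => rw [Function.update_eq_self]
  | @tail d e _ hs ih =>
    have := Λ.step_combine_update (c := Function.update c j d) j (d := e) (by simpa using hs)
    rw [Function.update_idem] at this
    exact ih.tail this

theorem reachable_combine_of_inner {c d : Fin k → Config k m}
    (h : ∀ j, ReflTransGen InnerStep (c j) (d j)) :
    ReflTransGen Step (Λ.combine c) (Λ.combine d) := by
  classical
  suffices H : ∀ S : Finset (Fin k), ReflTransGen Step (Λ.combine c)
      (Λ.combine fun j => if j ∈ S then d j else c j) by simpa using H Finset.univ
  intro S
  induction S using Finset.induction_on with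
  | empty => simpa using ReflTransGen.refl
  | insert i S hi ih =>
    refine ih.trans ?_
    have := Λ.reachable_combine_update (fun j => if j ∈ S then d j else c j) i (d := d i)
      (by simpa [hi] using h i)
    convert this using 2
    ext1 j
    by_cases hj : j = i
    · subst hj; simp
    · simp [hj]

/-- The chips of the blocks, except for the first and the last chip of each block, and the
remaining chip are arranged in the order in which they are fired by the root. -/
structure Central : Prop where
  lt_block : ∀ {i j : Fin k} {t u : Fin m}, i < j → 0 < (t : ℕ) → (t : ℕ) + 1 < m →
    0 < (u : ℕ) → (u : ℕ) + 1 < m → Λ.block i t < Λ.block j u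
  lt_rest : ∀ {j : Fin k} {t : Fin m}, (j : ℕ) < k / 2 → 0 < (t : ℕ) → (t : ℕ) + 1 < m →
    Λ.block j t < Λ.rest
  rest_lt : ∀ {j : Fin k} {t : Fin m}, k / 2 ≤ (j : ℕ) → 0 < (t : ℕ) → (t : ℕ) + 1 < m →
    Λ.rest < Λ.block j t

theorem parentRank_succAbove_val (j : Fin k) :
    (((parentRank k).succAbove j : Fin (k + 1)) : ℕ) =
      if (j : ℕ) < k / 2 then (j : ℕ) else j + 1 := by
  simp only [Fin.succAbove, parentRank, Fin.lt_def, Fin.val_castSucc]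
  split_ifs <;> simp

/-- The order in which `k + 1` chips are fired, from the chip that goes to the parent and the chips
that go to the children. -/
theorem exists_orderEmbedding (r : Fin n) (f : Fin k → Fin n) (hf : StrictMono f)
    (h1 : ∀ j : Fin k, (j : ℕ) < k / 2 → f j < r)
    (h2 : ∀ j : Fin k, k / 2 ≤ (j : ℕ) → r < f j) :
    ∃ s : Fin (k + 1) ↪o Fin n, s (parentRank k) = r ∧
      ∀ j, s ((parentRank k).succAbove j) = f j := by
  suffices H : StrictMono ((parentRank k).insertNth r f : Fin (k + 1) → Fin n) from
    ⟨OrderEmbedding.ofStrictMono _ H, by simp, by simp⟩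
  intro a b hab
  rcases Fin.eq_self_or_eq_succAbove (parentRank k) a with rfl | ⟨i, rfl⟩ <;>
    rcases Fin.eq_self_or_eq_succAbove (parentRank k) b with rfl | ⟨j, rfl⟩
  · exact absurd hab (lt_irrefl _)
  · simp only [Fin.insertNth_apply_same, Fin.insertNth_apply_succAbove]
    refine h2 j ?_
    rw [Fin.lt_def, parentRank_succAbove_val] at hab
    simp only [parentRank] at hab
    split_ifs at hab <;> omega
  · simp only [Fin.insertNth_apply_same, Fin.insertNth_apply_succAbove]
    refine h1 i ?_
    rw [Fin.lt_def, parentRank_succAbove_val] at hab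
    simp only [parentRank] at hab
    split_ifs at hab <;> omega
  · simp only [Fin.insertNth_apply_succAbove]
    exact hf ((Fin.strictMono_succAbove _).lt_iff_lt.1 hab)

/-- The chip sent up has fired chips on both sides; this is why `Central` may ignore both ends of
each block. -/
theorem parentRank_central (hk : 2 ≤ k) (s : Fin (k + 1) ↪o Fin m) :
    0 < (s (parentRank k) : ℕ) ∧ (s (parentRank k) : ℕ) + 1 < m := by
  have h1 : s 0 < s (parentRank k) := by
    rw [s.lt_iff_lt, Fin.lt_def]; simp only [parentRank, Fin.val_zero]; omega
  have h2 : s (parentRank k) < s (Fin.last k) := by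
    rw [s.lt_iff_lt, Fin.lt_def]; simp only [parentRank, Fin.val_last]; omega
  rw [Fin.lt_def] at h1 h2
  have := (s (Fin.last k)).2
  omega

/-- If every block fires its root, then the root can send every chip that it received back. -/
theorem reachable_combine_of_root (hk : 2 ≤ k) (hΛ : Λ.Central) {c d : Fin k → Config k m}
    {s : Fin k → Fin (k + 1) ↪o Fin m} (h : ∀ j, FiresTo [] (s j) (c j) (d j)) :
    ReflTransGen Step (Λ.combine c) (Λ.combine d) := by
  classical
  -- The blocks in `S` have fired at their child of the root, and the chip each sent up waits on the
  -- root.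
  let a : Finset (Fin k) → Fin k → Fin m → Vertex k := fun S j t =>
    if j ∈ S then if t = s j (parentRank k) then [] else d j t ++ [j] else c j t ++ [j]
  have H : ∀ S : Finset (Fin k), ReflTransGen Step (Λ.combine c) (Λ.place (a S)) := by
    intro S
    induction S using Finset.induction_on with
    | empty => simpa [a, combine] using ReflTransGen.refl
    | insert i S hi ih =>
      refine ih.tail ⟨[i], _, Λ.firesTo_block i (s i) (fun r => ?_) ?_ (fun j => ?_)
        (fun t ht => ?_) (fun j hj => ?_)⟩
      · simp [a, hi, (h i).on_vertex]
      · simp [a, parent]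
      · simp [a, (h i).to_child, child]
      · have : t ≠ s i (parentRank k) := fun e => ht ⟨_, e.symm⟩
        simp [a, hi, this, (h i).unmoved t ht]
      · ext1 t
        simp [a, hj]
  refine (H Finset.univ).tail ?_
  obtain ⟨S, hS1, hS2⟩ := exists_orderEmbedding Λ.rest
    (fun j => Λ.block j (s j (parentRank k)))
    (fun i j hij => hΛ.lt_block hij (parentRank_central hk _).1 (parentRank_central hk _).2
      (parentRank_central hk _).1 (parentRank_central hk _).2)
    (fun j hj => hΛ.lt_rest hj (parentRank_central hk _).1 (parentRank_central hk _).2)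
    (fun j hj => hΛ.rest_lt hj (parentRank_central hk _).1 (parentRank_central hk _).2)
  refine ⟨[], S, fun r => ?_, ?_, fun j => ?_, ?_⟩
  · rcases Fin.eq_self_or_eq_succAbove (parentRank k) r with rfl | ⟨i, rfl⟩
    · rw [hS1, place_rest]
    · rw [hS2, place_block]; simp [a]
  · rw [hS1]; simp [combine, parent]
  · rw [hS2]; simp [combine, (h j).to_parent, parent, child]
  · rw [Λ.forall_iff]
    refine ⟨by simp [combine], fun j t ht => ?_⟩
    have : t ≠ s j (parentRank k) := fun e => ht ⟨_, by rw [hS2 j, e]⟩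
    simp [combine, a, this]

/-- Induction on the common number of root firings: all copies are cut at their last one, these are
carried out together, and the inner moves follow. -/
theorem reachable_combine (hk : 2 ≤ k) (hΛ : Λ.Central) (b : ℕ) {c : Fin k → Config k m}
    {L : Fin k → List (Vertex k)} (h : ∀ j, Fired (L j) (c j)) (hb : ∀ j, (L j).count [] = b) :
    ReflTransGen Step (Λ.combine fun _ => initial k m) (Λ.combine c) := by
  induction b generalizing c L with
  | zero => exact Λ.reachable_combine_of_inner fun j => (h j).inner_of_count_eq_zero (hb j)
  | succ b ih =>
    choose L' d d' s h1 h2 h3 h4 using fun j => (h j).exists_last_root (hb j)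
    exact ((ih h1 h2).trans (Λ.reachable_combine_of_root hk hΛ h3)).trans
      (Λ.reachable_combine_of_inner h4)

/-- The chips of the blocks can be sent to the children of the root. -/
def Reachable : Prop := ReflTransGen Step (initial k n) (Λ.combine fun _ => initial k m)

/-- Stabilizing sequences from the same start fire the root equally often, which supplies the common
count. -/
theorem combine_mem_stableConfigs (hk : 2 ≤ k) (hΛ : Λ.Central) (hr : Λ.Reachable)
    {c : Fin k → Config k m} (hc : ∀ j, c j ∈ stableConfigs k m) :
    Λ.combine c ∈ stableConfigs k n := by
  choose L hL using fun j => exists_fired (hc j).1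
  refine ⟨hr.trans (Λ.reachable_combine hk hΛ ((L ⟨0, by omega⟩).count []) hL fun j =>
    (hL j).count_eq (hL _) (hc j).2 (hc _).2 []), Λ.isStable_combine (by omega) fun j => (hc j).2⟩

/-- A layout is reachable if the chips of the blocks can be fired row by row, starting with the
first and the last row. -/
theorem reachable_of_rows (hm : 2 ≤ m) (hΛ : Λ.Central) (x y : Fin n)
    (hmono : ∀ t, StrictMono fun j => Λ.block j t)
    (hx1 : ∀ j : Fin k, (j : ℕ) < k / 2 → Λ.block j ⟨0, by omega⟩ < x)
    (hx2 : ∀ j : Fin k, k / 2 ≤ (j : ℕ) → x < Λ.block j ⟨0, by omega⟩)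
    (hy1 : ∀ j : Fin k, (j : ℕ) < k / 2 → Λ.block j ⟨m - 1, by omega⟩ < y)
    (hy2 : ∀ j : Fin k, k / 2 ≤ (j : ℕ) → y < Λ.block j ⟨m - 1, by omega⟩)
    (hy : ∀ j : Fin k, Λ.block j ⟨0, by omega⟩ ≠ y) : Λ.Reachable := by
  classical
  let a : Finset (Fin m) → Fin k → Fin m → Vertex k := fun S j t => if t ∈ S then [j] else []
  -- `z` is the chip that the root keeps while row `t` goes down. The extreme rows need not be
  -- arranged around `Λ.rest`, so they use `x` and `y` instead.
  have H (S : Finset (Fin m)) (t : Fin m) (ht : t ∉ S) (z : Fin n)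
      (h1 : ∀ j : Fin k, (j : ℕ) < k / 2 → Λ.block j t < z)
      (h2 : ∀ j : Fin k, k / 2 ≤ (j : ℕ) → z < Λ.block j t)
      (h3 : ∀ j, ∀ u ∈ S, Λ.block j u ≠ z) :
      Step (Λ.place (a S)) (Λ.place (a (insert t S))) := by
    have hz (T : Finset (Fin m)) (hT : ∀ j, ∀ u ∈ T, Λ.block j u ≠ z) :
        Λ.place (a T) z = [] := by
      clear h1 h2 h3
      revert z
      rw [Λ.forall_iff]
      refine ⟨by simp, fun j u hu => ?_⟩
      rw [place_block]
      exact if_neg fun h => hu j u h rfl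
    obtain ⟨s, hs1, hs2⟩ := exists_orderEmbedding z _ (hmono t) h1 h2
    refine ⟨[], s, fun r => ?_, ?_, fun j => ?_, ?_⟩
    · rcases Fin.eq_self_or_eq_succAbove (parentRank k) r with rfl | ⟨i, rfl⟩
      · rw [hs1, hz S h3]
      · rw [hs2, place_block]; simp [a, ht]
    · rw [hs1, hz]
      · rfl
      intro j u hu
      rcases Finset.mem_insert.1 hu with rfl | hu
      · rcases lt_or_ge (j : ℕ) (k / 2) with h | h
        · exact (h1 j h).ne
        · exact (h2 j h).ne'
      · exact h3 j u hu
    · rw [hs2, place_block]; simp [a, child]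
    · rw [Λ.forall_iff]
      refine ⟨by simp, fun j u hu => ?_⟩
      have : u ≠ t := fun e => hu ⟨_, by rw [hs2 j, e]⟩
      simp [a, this]
  have h0 : initial k n = Λ.place (a ∅) := by
    ext1 x
    revert x
    rw [Λ.forall_iff]
    simp [initial, a]
  have hne : (⟨m - 1, by omega⟩ : Fin m) ≠ ⟨0, by omega⟩ := by
    rw [Ne, Fin.mk.injEq]; omega
  -- Both extreme rows are present from the start, so every row added later is central and `Λ.rest`
  -- can serve as `z`.
  have key (S : Finset (Fin m)) : ReflTransGen Step (initial k n)
      (Λ.place (a (S ∪ {⟨m - 1, by omega⟩, ⟨0, by omega⟩}))) := by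
    induction S using Finset.induction_on with
    | empty =>
      rw [h0, Finset.empty_union]
      refine (ReflTransGen.single (H ∅ ⟨0, by omega⟩ (by simp) x hx1 hx2 (by simp))).tail ?_
      rw [insert_empty_eq]
      refine H _ _ (by simpa using hne) y hy1 hy2 fun j u hu => ?_
      rw [Finset.mem_singleton.1 hu]
      exact hy j
    | insert t S ht ih =>
      rw [Finset.insert_union]
      by_cases hmem : t ∈ S ∪ {⟨m - 1, by omega⟩, ⟨0, by omega⟩}
      · rwa [Finset.insert_eq_of_mem hmem]
      · refine ih.tail (H _ t hmem Λ.rest ?_ ?_ fun j u _ => Λ.block_ne_rest j u)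
        all_goals
          simp only [Finset.mem_union, Finset.mem_insert, Finset.mem_singleton, not_or,
            Fin.ext_iff] at hmem
          have := t.2
          intro j hj
        · exact hΛ.lt_rest hj (by omega) (by omega)
        · exact hΛ.rest_lt hj (by omega) (by omega)
  have := key Finset.univ
  rw [show Finset.univ ∪ _ = (Finset.univ : Finset (Fin m)) from
    top_sup_eq _] at this
  simpa [Reachable, combine, a, initial] using this

end Layout

end ChipFiring

/-! ### Choice of the extreme chips of the blocks. -/

namespace ChipFiring

open Finset

theorem exists_top_subset {c : ℕ} (A : Finset ℕ) (hc : c ≤ A.card) :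
    ∃ U ⊆ A, U.card = c ∧ ∀ x ∈ A, x ∉ U → ∀ u ∈ U, x < u := by
  induction c generalizing A with
  | zero => exact ⟨∅, by simp, by simp, by simp⟩
  | succ c ih =>
    have hA : A.Nonempty := card_pos.1 (by omega)
    obtain ⟨U, h1, h2, h3⟩ := ih (A.erase (A.max' hA)) (by
      rw [card_erase_of_mem (max'_mem _ _)]; omega)
    have hU : A.max' hA ∉ U := fun h => by simpa using h1 h
    refine ⟨insert (A.max' hA) U, insert_subset (max'_mem _ _) (h1.trans (erase_subset _ _)),
      by rw [card_insert_of_notMem hU, h2], fun x hx hxU u hu => ?_⟩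
    rw [mem_insert, not_or] at hxU
    rcases mem_insert.1 hu with rfl | hu
    · exact lt_of_le_of_ne (le_max' _ _ hx) hxU.1
    · exact h3 x (mem_erase.2 ⟨hxU.1, hx⟩) hxU.2 u hu

theorem exists_bottom_subset {c : ℕ} (A : Finset ℕ) (hc : c ≤ A.card) :
    ∃ U ⊆ A, U.card = c ∧ ∀ x ∈ A, x ∉ U → ∀ u ∈ U, u < x := by
  obtain ⟨U, h1, h2, h3⟩ := exists_top_subset (c := A.card - c) A (by omega)
  refine ⟨A \ U, sdiff_subset, by rw [card_sdiff_of_subset h1]; omega, fun x hx hxU u hu => ?_⟩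
  rw [mem_sdiff] at hu hxU
  exact h3 u hu.1 hu.2 x (by tauto)

theorem exists_enumeration {c : ℕ} {S : Finset ℕ} (h : S.card = c) :
    ∃ f : ℕ → ℕ, (∀ a < c, f a ∈ S) ∧ (∀ a b, a < b → b < c → f a < f b) ∧
      ∀ x ∈ S, ∃ a < c, f a = x := by
  refine ⟨fun a => if ha : a < c then S.orderEmbOfFin h ⟨a, ha⟩ else 0, fun a ha => ?_,
    fun a b hab hb => ?_, fun x hx => ?_⟩
  · simp [ha]
  · simp [hab.trans hb, hb, hab]
  · obtain ⟨y, hy⟩ : x ∈ Set.range (S.orderEmbOfFin h) := by simpa using hx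
    exact ⟨y, y.2, by simpa using hy⟩

/-- Sequences that describe the blocks of a layout in which the chips of `X` and `Y` change
sides. -/
structure Pattern (p q w : ℕ) (X Y : Finset ℕ) where
  /-- The largest chips of the left blocks. -/
  left : ℕ → ℕ
  /-- The smallest chips of the right blocks. -/
  right : ℕ → ℕ
  /-- The chips that are fired in increasing order. -/
  mid : ℕ → ℕ
  left_lt {a b} : a < b → b < p → left a < left b
  right_lt {a b} : a < b → b < q → right a < right b
  mid_lt {a b} : a < b → b < w * p + w * q + 1 → mid a < mid b
  mid_rest : mid (w * p) = (w + 2) * p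
  left_mem {a} : a < p → p < left a ∧ left a < (w + 2) * p + (w + 2) * q - q
  right_mem {a} : a < q → p < right a ∧ right a < (w + 2) * p + (w + 2) * q - q
  mid_mem {a} : a < w * p + w * q + 1 → p ≤ mid a ∧ mid a ≤ (w + 2) * p + (w + 2) * q - q
  left_ne_right {a b} : a < p → b < q → left a ≠ right b
  mid_ne_left {a b} : a < w * p + w * q + 1 → b < p → mid a ≠ left b
  mid_ne_right {a b} : a < w * p + w * q + 1 → b < q → mid a ≠ right b
  mid_lt_left {a b} : a < w * p → b < p → mid a < left b
  right_lt_mid {a b} : w * p < a → a < w * p + w * q + 1 → b < q → right b < mid a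
  mem_left {x} : (w + 2) * p < x → (x ∈ Y ↔ ∃ a < p, left a = x)
  mem_right {x} : x < (w + 2) * p → (x ∈ X ↔ ∃ a < q, right a = x)

/-- The left blocks end with `Y` and the `p - i` largest chips below the kept one outside `X`; the
right blocks begin with `X` and the `q - i` smallest above it outside `Y`. Since `X` and `Y` have
equal size, exactly `w * p` middle chips remain below the kept chip. -/
theorem nonempty_pattern {p q w i : ℕ} {X Y : Finset ℕ} (hp : 1 ≤ p) (hpq : p ≤ q) (hw : 1 ≤ w)
    (hi : i ≤ p) (hX : X ∈ powersetCard i (Ioo p ((w + 2) * p)))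
    (hY : Y ∈ powersetCard i (Ioo ((w + 2) * p) ((w + 2) * p + (w + 2) * q - q))) :
    Nonempty (Pattern p q w X Y) := by
  rw [mem_powersetCard] at hX hY
  obtain ⟨hX, hXi⟩ := hX
  obtain ⟨hY, hYi⟩ := hY
  have e1 : (w + 2) * p = w * p + 2 * p := by ring
  have e2 : (w + 2) * q = w * q + 2 * q := by ring
  have e3 : p ≤ w * p := Nat.le_mul_of_pos_left p hw
  have e4 : q ≤ w * q := Nat.le_mul_of_pos_left q hw
  generalize hP : w * p = P at *
  generalize hQ : w * q = Q at *
  generalize hR : (w + 2) * p = r at *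
  generalize hR' : (w + 2) * q = r' at *
  obtain ⟨U, hU1, hU2, hU3⟩ := exists_top_subset (c := p - i) (Ioo p r \ X) (by
    rw [card_sdiff_of_subset hX, Nat.card_Ioo]; omega)
  obtain ⟨V, hV1, hV2, hV3⟩ := exists_bottom_subset (c := q - i) (Ioo r (r + r' - q) \ Y) (by
    rw [card_sdiff_of_subset hY, Nat.card_Ioo]; omega)
  have mX {x} (h : x ∈ X) : p < x ∧ x < r := mem_Ioo.1 (hX h)
  have mY {x} (h : x ∈ Y) : r < x ∧ x < r + r' - q := mem_Ioo.1 (hY h)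
  have mU {x} (h : x ∈ U) : (p < x ∧ x < r) ∧ x ∉ X := by simpa using hU1 h
  have mV {x} (h : x ∈ V) : (r < x ∧ x < r + r' - q) ∧ x ∉ Y := by simpa using hV1 h
  have dUY : Disjoint U Y := disjoint_left.2 fun x h h' => by
    have := mU h; have := mY h'; omega
  have dXV : Disjoint X V := disjoint_left.2 fun x h h' => by
    have := mX h; have := mV h'; omega
  have dXU : Disjoint X U := disjoint_left.2 fun x h h' => (mU h').2 h
  have dLR : Disjoint (U ∪ Y) (X ∪ V) := disjoint_left.2 fun x h h' => by
    rcases mem_union.1 h with h | h <;> rcases mem_union.1 h' with h' | h'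
    · exact (mU h).2 h'
    · have := mU h; have := mV h'; omega
    · have := mY h; have := mX h'; omega
    · exact (mV h').2 h
  have cL : (U ∪ Y).card = p := by rw [card_union_of_disjoint dUY]; omega
  have cR : (X ∪ V).card = q := by rw [card_union_of_disjoint dXV]; omega
  have mL {x} (h : x ∈ U ∪ Y) : p < x ∧ x < r + r' - q := by
    rcases mem_union.1 h with h | h
    · have := mU h; omega
    · have := mY h; omega
  have mR {x} (h : x ∈ X ∪ V) : p < x ∧ x < r + r' - q := by
    rcases mem_union.1 h with h | h
    · have := mX h; omega
    · have := mV h; omega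
  have sub : (U ∪ Y) ∪ (X ∪ V) ⊆ Icc p (r + r' - q) := fun x h => by
    rcases mem_union.1 h with h | h
    · have := mL h; exact mem_Icc.2 (by omega)
    · have := mR h; exact mem_Icc.2 (by omega)
  obtain ⟨el, el1, el2, el3⟩ := exists_enumeration cL
  obtain ⟨er, er1, er2, er3⟩ := exists_enumeration cR
  obtain ⟨e, he1, he2, he3⟩ := exists_enumeration (c := P + Q + 1)
    (S := Icc p (r + r' - q) \ ((U ∪ Y) ∪ (X ∪ V))) (by
      rw [card_sdiff_of_subset sub, card_union_of_disjoint dLR, Nat.card_Icc]; omega)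
  have he4 {a} (ha : a < P + Q + 1) : (p ≤ e a ∧ e a ≤ r + r' - q) ∧ e a ∉ U ∪ Y ∧
      e a ∉ X ∪ V := by
    have := he1 a ha
    rw [mem_sdiff, mem_Icc, mem_union, not_or] at this
    exact this
  have hr : e P = r := by
    obtain ⟨a, ha, har⟩ := he3 r (by
      rw [mem_sdiff, mem_union, not_or, mem_union, mem_union, mem_Icc]
      refine ⟨by omega, fun h => ?_, fun h => ?_⟩
      · rcases h with h | h
        · have := mU h; omega
        · have := mY h; omega
      · rcases h with h | h
        · have := mX h; omega
        · have := mV h; omega)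
    -- The chips enumerated before `r` are counted: `(r - p) - i - (p - i) = w * p`.
    have h1 : (range a).image e = Ico p r \ (X ∪ U) := by
      ext x
      rw [mem_image, mem_sdiff, mem_Ico, mem_union, not_or]
      constructor
      · rintro ⟨b, hb, rfl⟩
        rw [mem_range] at hb
        have h := he2 b a hb ha
        have h' := he4 (hb.trans ha)
        simp only [mem_union, not_or] at h'
        exact ⟨by omega, h'.2.2.1, h'.2.1.1⟩
      · rintro ⟨h, h', h''⟩
        obtain ⟨b, hb, rfl⟩ := he3 x (by
          rw [mem_sdiff, mem_union, not_or, mem_union, mem_union, mem_Icc]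
          refine ⟨by omega, fun h3 => ?_, fun h3 => ?_⟩
          · rcases h3 with h3 | h3
            · exact h'' h3
            · have := mY h3; omega
          · rcases h3 with h3 | h3
            · exact h' h3
            · have := mV h3; omega)
        refine ⟨b, mem_range.2 ?_, rfl⟩
        by_contra hab
        rcases (not_lt.1 hab).eq_or_lt with rfl | hab
        · omega
        · have := he2 a b hab hb; omega
    have h2 : X ∪ U ⊆ Ico p r := fun x h => by
      rcases mem_union.1 h with h | h
      · have := mX h; exact mem_Ico.2 (by omega)
      · have := mU h; exact mem_Ico.2 (by omega)
    have h3 := congrArg card h1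
    rw [card_image_of_injOn, card_sdiff_of_subset h2, card_union_of_disjoint dXU, Nat.card_Ico,
      card_range] at h3
    · rw [← har]; congr 1; omega
    · intro x hx y hy hxy
      simp only [coe_range, Set.mem_Iio] at hx hy
      rcases lt_trichotomy x y with h | h | h
      · have := he2 x y h (by omega); omega
      · exact h
      · have := he2 y x h (by omega); omega
  subst hP hQ hR hR'
  refine ⟨{
    left := el, right := er, mid := e
    left_lt := @fun a b => el2 a b
    right_lt := @fun a b => er2 a b
    mid_lt := @fun a b => he2 a b
    mid_rest := hr
    left_mem := @fun a ha => mL (el1 a ha)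
    right_mem := @fun a ha => mR (er1 a ha)
    mid_mem := @fun a ha => (he4 ha).1
    left_ne_right := @fun a b ha hb h => disjoint_left.1 dLR (el1 a ha) (h ▸ er1 b hb)
    mid_ne_left := @fun a b ha hb h => (he4 ha).2.1 (h ▸ el1 b hb)
    mid_ne_right := @fun a b ha hb h => (he4 ha).2.2 (h ▸ er1 b hb)
    mid_lt_left := @fun a b ha hb => ?_
    right_lt_mid := @fun a b ha ha' hb => ?_
    mem_left := @fun x hx => ⟨fun h => el3 x (mem_union_right _ h), ?_⟩
    mem_right := @fun x hx => ⟨fun h => er3 x (mem_union_left _ h), ?_⟩ }⟩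
  · have h1 := he4 (a := a) (by omega)
    have h2 := he2 a _ ha (by omega)
    rcases mem_union.1 (el1 b hb) with h | h
    -- The chip `p` lies outside the open interval from which `U` was chosen, so it is treated
    -- separately.
    · rcases h1.1.1.eq_or_lt with h3 | h3
      · rw [← h3]; exact (mU h).1.1
      · refine hU3 _ ?_ (fun h' => h1.2.1 (mem_union_left _ h')) _ h
        exact mem_sdiff.2 ⟨mem_Ioo.2 (by omega), fun h' => h1.2.2 (mem_union_left _ h')⟩
    · have := mY h; omega
  · have h1 := he4 (a := a) (by omega)
    have h2 := he2 _ a ha (by omega)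
    rcases mem_union.1 (er1 b hb) with h | h
    · have := mX h; omega
    · rcases h1.1.2.eq_or_lt with h3 | h3
      · rw [h3]; exact (mV h).1.2
      · refine hV3 _ ?_ (fun h' => h1.2.2 (mem_union_right _ h')) _ h
        exact mem_sdiff.2 ⟨mem_Ioo.2 (by omega), fun h' => h1.2.1 (mem_union_right _ h')⟩
  · rintro ⟨a, ha, rfl⟩
    rcases mem_union.1 (el1 a ha) with h | h
    · have := mU h; omega
    · exact h
  · rintro ⟨a, ha, rfl⟩
    rcases mem_union.1 (er1 a ha) with h | h
    · exact h
    · have := mV h; omega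

end ChipFiring

/-! ### From a pattern to a reachable layout. -/

namespace ChipFiring

open Finset

/-- The place, in the increasing sequence of the chips fired in order, of the `t`-th chip of the
`j`-th block. -/
def midIndex (p w j t : ℕ) : ℕ := w * j + if j < p then t - 1 else t

section midIndex

variable {p q w i j t u : ℕ}

/-- The index `w * p` is reserved for the kept chip: left blocks stay below it, and the shift by one
puts right blocks above it. -/
theorem midIndex_lt (hj : j < p) (ht : 0 < t) (ht' : t < w + 1) : midIndex p w j t < w * p := by
  have : w * (j + 1) ≤ w * p := Nat.mul_le_mul_left w hj
  rw [midIndex, if_pos hj]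
  rw [mul_add] at this
  omega

theorem lt_midIndex (hj : p ≤ j) (ht : 0 < t) : w * p < midIndex p w j t := by
  have : w * p ≤ w * j := Nat.mul_le_mul_left w hj
  rw [midIndex, if_neg (by omega)]
  omega

theorem midIndex_lt_add_one (hj : j < p + q) (ht : 0 < t) (ht' : t < w + 1) :
    midIndex p w j t < w * p + w * q + 1 := by
  have : w * (j + 1) ≤ w * (p + q) := Nat.mul_le_mul_left w hj
  rw [mul_add, mul_add] at this
  rw [midIndex]
  split_ifs <;> omega

theorem midIndex_lt_of_lt (hij : i < j) (ht : 0 < t) (ht' : t < w + 1) (hu : 0 < u) :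
    midIndex p w i t < midIndex p w j u := by
  have : w * (i + 1) ≤ w * j := Nat.mul_le_mul_left w hij
  rw [mul_add] at this
  rw [midIndex, midIndex]
  split_ifs <;> omega

theorem midIndex_strictMono (ht : 0 < t) (htu : t < u) : midIndex p w j t < midIndex p w j u := by
  rw [midIndex, midIndex]
  split_ifs <;> omega

end midIndex

namespace Pattern

variable {p q w : ℕ} {X Y : Finset ℕ} (P : Pattern p q w X Y)

/-- The `t`-th chip of the `j`-th block. -/
def chip (j t : ℕ) : ℕ :=
  if t = 0 then (if j < p then j else P.right (j - p))
  else if t = w + 1 then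
    -- For `p ≤ j < p + q` these are the `q` largest chips.
    (if j < p then P.left j else (w + 2) * p + (w + 2) * q + 1 - (p + q) + j)
  else P.mid (midIndex p w j t)

theorem chip_zero_of_lt {j : ℕ} (hj : j < p) : P.chip j 0 = j := by simp [chip, hj]

theorem chip_zero_of_le {j : ℕ} (hj : p ≤ j) : P.chip j 0 = P.right (j - p) := by
  simp [chip, hj.not_gt]

theorem chip_last_of_lt {j : ℕ} (hj : j < p) : P.chip j (w + 1) = P.left j := by simp [chip, hj]

theorem chip_last_of_le {j : ℕ} (hj : p ≤ j) :
    P.chip j (w + 1) = (w + 2) * p + (w + 2) * q + 1 - (p + q) + j := by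
  simp [chip, hj.not_gt]

theorem chip_mid {j t : ℕ} (ht : 0 < t) (ht' : t < w + 1) :
    P.chip j t = P.mid (midIndex p w j t) := by
  rw [chip, if_neg (by omega), if_neg (by omega)]

theorem size_bounds (p q w : ℕ) :
    2 * p ≤ (w + 2) * p ∧ 2 * q ≤ (w + 2) * q :=
  ⟨Nat.mul_le_mul_right p (by omega), Nat.mul_le_mul_right q (by omega)⟩

theorem chip_cases {t : ℕ} (ht : t < w + 2) : t = 0 ∨ (0 < t ∧ t < w + 1) ∨ t = w + 1 := by
  omega

theorem chip_lt {j t : ℕ} (hj : j < p + q) (ht : t < w + 2) :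
    P.chip j t < (w + 2) * p + (w + 2) * q + 1 := by
  have := size_bounds p q w
  rcases chip_cases ht with rfl | ⟨ht1, ht2⟩ | rfl <;> rcases lt_or_ge j p with h | h
  · rw [P.chip_zero_of_lt h]; omega
  · rw [P.chip_zero_of_le h]
    have := P.right_mem (a := j - p) (by omega)
    omega
  · rw [P.chip_mid ht1 ht2]
    have := P.mid_mem (midIndex_lt_add_one hj ht1 ht2)
    omega
  · rw [P.chip_mid ht1 ht2]
    have := P.mid_mem (midIndex_lt_add_one hj ht1 ht2)
    omega
  · rw [P.chip_last_of_lt h]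
    have := P.left_mem h
    omega
  · rw [P.chip_last_of_le h]; omega

theorem chip_zero_lt_mid {j t : ℕ} (hj : j < p + q) (ht : 0 < t) (ht' : t < w + 1) :
    P.chip j 0 < P.chip j t := by
  rw [P.chip_mid ht ht']
  rcases lt_or_ge j p with h | h
  · rw [P.chip_zero_of_lt h]
    have := P.mid_mem (midIndex_lt_add_one hj ht ht')
    omega
  · rw [P.chip_zero_of_le h]
    exact P.right_lt_mid (lt_midIndex h ht) (midIndex_lt_add_one hj ht ht') (by omega)

theorem chip_mid_lt_last {j t : ℕ} (hj : j < p + q) (ht : 0 < t) (ht' : t < w + 1) :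
    P.chip j t < P.chip j (w + 1) := by
  have := size_bounds p q w
  rw [P.chip_mid ht ht']
  rcases lt_or_ge j p with h | h
  · rw [P.chip_last_of_lt h]
    exact P.mid_lt_left (midIndex_lt h ht ht') h
  · rw [P.chip_last_of_le h]
    have := P.mid_mem (midIndex_lt_add_one hj ht ht')
    omega

theorem chip_lt_of_lt (hw : 1 ≤ w) {j t u : ℕ} (hj : j < p + q) (htu : t < u) (hu : u < w + 2) :
    P.chip j t < P.chip j u := by
  rcases chip_cases hu with rfl | ⟨hu1, hu2⟩ | rfl
  · omega
  · rcases chip_cases (htu.trans hu) with rfl | ⟨ht1, ht2⟩ | rfl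
    · exact P.chip_zero_lt_mid hj hu1 hu2
    · rw [P.chip_mid ht1 ht2, P.chip_mid hu1 hu2]
      exact P.mid_lt (midIndex_strictMono ht1 htu) (midIndex_lt_add_one hj hu1 hu2)
    · omega
  · rcases chip_cases (htu.trans hu) with rfl | ⟨ht1, ht2⟩ | rfl
    -- The first and last chips are compared through a middle one, which exists because `1 ≤ w`.
    · exact (P.chip_zero_lt_mid hj one_pos (by omega)).trans
        (P.chip_mid_lt_last hj one_pos (by omega))
    · exact P.chip_mid_lt_last hj ht1 ht2
    · omega

theorem chip_mid_lt_of_lt {i j t u : ℕ} (hij : i < j) (hj : j < p + q) (ht : 0 < t)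
    (ht' : t < w + 1) (hu : 0 < u) (hu' : u < w + 1) : P.chip i t < P.chip j u := by
  rw [P.chip_mid ht ht', P.chip_mid hu hu']
  exact P.mid_lt (midIndex_lt_of_lt hij ht ht' hu) (midIndex_lt_add_one hj hu hu')

theorem chip_mid_lt_rest {j t : ℕ} (hj : j < p) (ht : 0 < t) (ht' : t < w + 1) :
    P.chip j t < (w + 2) * p := by
  rw [P.chip_mid ht ht', ← P.mid_rest]
  exact P.mid_lt (midIndex_lt hj ht ht') (by omega)

theorem rest_lt_chip_mid {j t : ℕ} (hj : p ≤ j) (hj' : j < p + q) (ht : 0 < t)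
    (ht' : t < w + 1) : (w + 2) * p < P.chip j t := by
  rw [P.chip_mid ht ht', ← P.mid_rest]
  exact P.mid_lt (lt_midIndex hj ht) (midIndex_lt_add_one hj' ht ht')

theorem chip_row_lt {i j t : ℕ} (hij : i < j) (hj : j < p + q) (ht : t < w + 2) :
    P.chip i t < P.chip j t := by
  have := size_bounds p q w
  rcases chip_cases ht with rfl | ⟨ht1, ht2⟩ | rfl
  · rcases lt_or_ge j p with h | h
    · rwa [P.chip_zero_of_lt h, P.chip_zero_of_lt (hij.trans h)]
    rw [P.chip_zero_of_le h]
    have := P.right_mem (a := j - p) (by omega)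
    rcases lt_or_ge i p with h' | h'
    · rw [P.chip_zero_of_lt h']; omega
    · rw [P.chip_zero_of_le h']; exact P.right_lt (by omega) (by omega)
  · exact P.chip_mid_lt_of_lt hij hj ht1 ht2 ht1 ht2
  · rcases lt_or_ge j p with h | h
    · rw [P.chip_last_of_lt h, P.chip_last_of_lt (hij.trans h)]
      exact P.left_lt hij h
    rw [P.chip_last_of_le h]
    rcases lt_or_ge i p with h' | h'
    · rw [P.chip_last_of_lt h']
      have := P.left_mem h'
      omega
    · rw [P.chip_last_of_le h']; omega

theorem chip_zero_ne_mid {i a : ℕ} (hi : i < p + q) (ha : a < w * p + w * q + 1) :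
    P.chip i 0 ≠ P.mid a := by
  rcases lt_or_ge i p with h | h
  · rw [P.chip_zero_of_lt h]
    have := P.mid_mem ha
    omega
  · rw [P.chip_zero_of_le h]
    exact (P.mid_ne_right ha (by omega)).symm

theorem chip_last_ne_mid {i a : ℕ} (ha : a < w * p + w * q + 1) :
    P.chip i (w + 1) ≠ P.mid a := by
  have := size_bounds p q w
  rcases lt_or_ge i p with h | h
  · rw [P.chip_last_of_lt h]
    exact (P.mid_ne_left ha h).symm
  · rw [P.chip_last_of_le h]
    have := P.mid_mem ha
    omega

theorem chip_zero_ne_last {i j : ℕ} (hi : i < p + q) : P.chip i 0 ≠ P.chip j (w + 1) := by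
  have := size_bounds p q w
  rcases lt_or_ge i p with h | h <;> rcases lt_or_ge j p with h' | h'
  · rw [P.chip_zero_of_lt h, P.chip_last_of_lt h']
    have := P.left_mem h'
    omega
  · rw [P.chip_zero_of_lt h, P.chip_last_of_le h']; omega
  · rw [P.chip_zero_of_le h, P.chip_last_of_lt h']
    exact (P.left_ne_right h' (by omega)).symm
  · rw [P.chip_zero_of_le h, P.chip_last_of_le h']
    have := P.right_mem (a := i - p) (by omega)
    omega

theorem chip_ne_rest {j t : ℕ} (hj : j < p + q) (ht : t < w + 2) :
    P.chip j t ≠ (w + 2) * p := by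
  rcases chip_cases ht with rfl | ⟨ht1, ht2⟩ | rfl
  · rw [← P.mid_rest]; exact P.chip_zero_ne_mid hj (by omega)
  · rcases lt_or_ge j p with h | h
    · exact (P.chip_mid_lt_rest h ht1 ht2).ne
    · exact (P.rest_lt_chip_mid h hj ht1 ht2).ne'
  · rw [← P.mid_rest]; exact P.chip_last_ne_mid (by omega)

theorem chip_ne_of_lt {i j t u : ℕ} (hij : i < j) (hj : j < p + q) (ht : t < w + 2)
    (hu : u < w + 2) : P.chip i t ≠ P.chip j u := by
  intro h
  have hi := hij.trans hj
  by_cases htu : t = u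
  · subst htu; exact (P.chip_row_lt hij hj ht).ne h
  rcases chip_cases ht with rfl | ⟨ht1, ht2⟩ | rfl <;>
    rcases chip_cases hu with rfl | ⟨hu1, hu2⟩ | rfl
  · exact htu rfl
  · exact P.chip_zero_ne_mid hi (midIndex_lt_add_one hj hu1 hu2) (h.trans (P.chip_mid hu1 hu2))
  · exact P.chip_zero_ne_last hi h
  · exact P.chip_zero_ne_mid hj (midIndex_lt_add_one hi ht1 ht2)
      (h.symm.trans (P.chip_mid ht1 ht2))
  · exact (P.chip_mid_lt_of_lt hij hj ht1 ht2 hu1 hu2).ne h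
  · exact P.chip_last_ne_mid (midIndex_lt_add_one hi ht1 ht2)
      (h.symm.trans (P.chip_mid ht1 ht2))
  · exact P.chip_zero_ne_last hj h.symm
  · exact P.chip_last_ne_mid (midIndex_lt_add_one hj hu1 hu2) (h.trans (P.chip_mid hu1 hu2))
  · exact htu rfl

theorem chip_inj (hw : 1 ≤ w) {i j t u : ℕ} (hi : i < p + q) (hj : j < p + q) (ht : t < w + 2)
    (hu : u < w + 2) (h : P.chip i t = P.chip j u) : i = j ∧ t = u := by
  rcases lt_trichotomy i j with hij | rfl | hij
  · exact absurd h (P.chip_ne_of_lt hij hj ht hu)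
  · refine ⟨rfl, ?_⟩
    rcases lt_trichotomy t u with h' | h' | h'
    · exact absurd h (P.chip_lt_of_lt hw hi h' hu).ne
    · exact h'
    · exact absurd h (P.chip_lt_of_lt hw hi h' ht).ne'
  · exact absurd h.symm (P.chip_ne_of_lt hij hi hu ht)

/-- The chips of `X` are the small ones in the right blocks. -/
theorem mem_right_iff {x : ℕ} (hx : x < (w + 2) * p) :
    x ∈ X ↔ ∃ j t, p ≤ j ∧ j < p + q ∧ t < w + 2 ∧ P.chip j t = x := by
  have := size_bounds p q w
  rw [P.mem_right hx]
  constructor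
  · rintro ⟨a, ha, rfl⟩
    exact ⟨p + a, 0, by omega, by omega, by omega, by
      rw [P.chip_zero_of_le (by omega)]; congr 1; omega⟩
  · rintro ⟨j, t, hj, hj', ht, rfl⟩
    rcases chip_cases ht with rfl | ⟨ht1, ht2⟩ | rfl
    · exact ⟨j - p, by omega, (P.chip_zero_of_le hj).symm⟩
    · exact absurd hx (P.rest_lt_chip_mid hj hj' ht1 ht2).not_gt
    · rw [P.chip_last_of_le hj] at hx; omega

/-- The chips of `Y` are the large ones in the left blocks. -/
theorem mem_left_iff {x : ℕ} (hx : (w + 2) * p < x) :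
    x ∈ Y ↔ ∃ j t, j < p ∧ t < w + 2 ∧ P.chip j t = x := by
  have := size_bounds p q w
  rw [P.mem_left hx]
  constructor
  · rintro ⟨a, ha, rfl⟩
    exact ⟨a, w + 1, ha, by omega, P.chip_last_of_lt ha⟩
  · rintro ⟨j, t, hj, ht, rfl⟩
    rcases chip_cases ht with rfl | ⟨ht1, ht2⟩ | rfl
    · rw [P.chip_zero_of_lt hj] at hx; omega
    · exact absurd hx (P.chip_mid_lt_rest hj ht1 ht2).not_gt
    · exact ⟨j, hj, (P.chip_last_of_lt hj).symm⟩

end Pattern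

/-- Every pattern gives a reachable layout. -/
theorem Pattern.exists_layout {k w : ℕ} {X Y : Finset ℕ} (hk : 2 ≤ k) (hw : 1 ≤ w)
    (P : Pattern (k / 2) (k - k / 2) w X Y) :
    ∃ Λ : Layout k (w + 2) (k * (w + 2) + 1), Λ.Central ∧ Λ.Reachable ∧
      ∀ j t, (Λ.block j t : ℕ) = P.chip j t := by
  have hpq : k / 2 + (k - k / 2) = k := by omega
  have hn : (w + 2) * (k / 2) + (w + 2) * (k - k / 2) + 1 = k * (w + 2) + 1 := by
    rw [← mul_add, hpq, mul_comm]
  have hb := Pattern.size_bounds (k / 2) (k - k / 2) w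
  have lt (j : Fin k) (t : Fin (w + 2)) : P.chip j t < k * (w + 2) + 1 :=
    hn ▸ P.chip_lt (by omega) t.2
  let b : Fin k → Fin (w + 2) ↪o Fin (k * (w + 2) + 1) := fun j =>
    OrderEmbedding.ofStrictMono (fun t => ⟨P.chip j t, lt j t⟩) fun t u htu =>
      P.chip_lt_of_lt hw (by omega) htu u.2
  have hinj : Function.Injective fun o : Option (Fin k × Fin (w + 2)) =>
      o.elim (⟨(w + 2) * (k / 2), by omega⟩ : Fin (k * (w + 2) + 1)) fun y => b y.1 y.2 := by
    rintro (_ | ⟨i, t⟩) (_ | ⟨j, u⟩) h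
    · rfl
    · exact absurd (congrArg Fin.val h).symm (P.chip_ne_rest (by omega) u.2)
    · exact absurd (congrArg Fin.val h) (P.chip_ne_rest (by omega) t.2)
    · obtain ⟨h1, h2⟩ := P.chip_inj hw (by omega) (by omega) t.2 u.2 (congrArg Fin.val h)
      obtain rfl : i = j := Fin.ext h1
      obtain rfl : t = u := Fin.ext h2
      rfl
  let Λ : Layout k (w + 2) (k * (w + 2) + 1) :=
    ⟨b, ⟨(w + 2) * (k / 2), by omega⟩, by
      rw [Fintype.bijective_iff_injective_and_card]
      exact ⟨hinj, by simp⟩⟩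
  have hΛ : Λ.Central :=
    ⟨fun {i j t u} hij ht ht' hu hu' => P.chip_mid_lt_of_lt hij (by omega) ht (by omega) hu
      (by omega), fun hj ht ht' => P.chip_mid_lt_rest hj ht (by omega),
      fun hj ht ht' => P.rest_lt_chip_mid hj (by omega) ht (by omega)⟩
  -- The root keeps chip `p`, just above the `p` smallest, for the first row, and the chip just
  -- below the `q` largest for the last row.
  refine ⟨Λ, hΛ, Λ.reachable_of_rows (by omega) hΛ ⟨k / 2, by omega⟩
    ⟨(w + 2) * (k / 2) + (w + 2) * (k - k / 2) - (k - k / 2), by omega⟩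
    (fun t i j hij => P.chip_row_lt hij (by omega) t.2)
    (fun j hj => ?_) (fun j hj => ?_) (fun j hj => ?_) (fun j hj => ?_) (fun j => ?_),
    fun j t => rfl⟩
  · change P.chip j 0 < k / 2
    rwa [P.chip_zero_of_lt hj]
  · change k / 2 < P.chip j 0
    rw [P.chip_zero_of_le hj]
    exact (P.right_mem (by omega)).1
  · change P.chip j (w + 1) < _
    rw [P.chip_last_of_lt hj]
    exact (P.left_mem hj).2
  · change (w + 2) * (k / 2) + (w + 2) * (k - k / 2) - (k - k / 2) < P.chip j (w + 1)
    rw [P.chip_last_of_le hj]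
    omega
  · intro h
    have h' : P.chip j 0 = (w + 2) * (k / 2) + (w + 2) * (k - k / 2) - (k - k / 2) :=
      congrArg Fin.val h
    rcases lt_or_ge (j : ℕ) (k / 2) with hj | hj
    · rw [P.chip_zero_of_lt hj] at h'; omega
    · rw [P.chip_zero_of_le hj] at h'
      have := P.right_mem (a := j - k / 2) (by omega)
      omega

end ChipFiring

/-! ### Counting the configurations. -/

namespace ChipFiring

open Finset

theorem append_singleton_inj {k : ℕ} {v w : Vertex k} {i j : Fin k} (h : v ++ [i] = w ++ [j]) :
    i = j := by
  simpa using (List.append_inj' h rfl).2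

/-- Two patterns with the same combined configurations move the same chips. -/
theorem Pattern.subset_of_combine_eq {k w : ℕ} {X Y X' Y' : Finset ℕ}
    (P : Pattern (k / 2) (k - k / 2) w X Y) (P' : Pattern (k / 2) (k - k / 2) w X' Y')
    {Λ Λ' : Layout k (w + 2) (k * (w + 2) + 1)}
    (hΛ : ∀ j t, (Λ.block j t : ℕ) = P.chip j t) (hΛ' : ∀ j t, (Λ'.block j t : ℕ) = P'.chip j t)
    {c c' : Fin k → Config k (w + 2)} (h : Λ.combine c = Λ'.combine c')
    (hX : ∀ x ∈ X, x < (w + 2) * (k / 2)) (hY : ∀ y ∈ Y, (w + 2) * (k / 2) < y) :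
    X ⊆ X' ∧ Y ⊆ Y' := by
  -- The last entry of a chip's address names its block, and only the kept chip has an empty
  -- address.
  have key (j : Fin k) (t : Fin (w + 2)) : ∃ u, Λ'.block j u = Λ.block j t := by
    have h1 := congrFun h (Λ.block j t)
    rw [Layout.combine, Layout.place_block] at h1
    obtain ⟨_ | ⟨i, u⟩, hx⟩ := Λ'.bijective.2 (Λ.block j t)
    · have hx' : Λ'.rest = Λ.block j t := hx
      rw [← hx', Layout.combine, Layout.place_rest] at h1
      simp at h1
    · have hx' : Λ'.block i u = Λ.block j t := hx
      rw [← hx', Layout.combine, Layout.place_block] at h1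
      obtain rfl := append_singleton_inj h1
      exact ⟨u, hx'⟩
  have key' {j t : ℕ} (hj : j < k) (ht : t < w + 2) :
      ∃ u < w + 2, P'.chip j u = P.chip j t := by
    obtain ⟨u, hu⟩ := key ⟨j, hj⟩ ⟨t, ht⟩
    refine ⟨u, u.2, ?_⟩
    have := congrArg Fin.val hu
    rwa [hΛ, hΛ'] at this
  constructor
  · intro x hx
    obtain ⟨j, t, hj, hj', ht, rfl⟩ := (P.mem_right_iff (hX x hx)).1 hx
    obtain ⟨u, hu, h2⟩ := key' (show j < k by omega) ht
    exact (P'.mem_right_iff (hX _ hx)).2 ⟨j, u, hj, hj', hu, h2⟩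
  · intro y hy
    obtain ⟨j, t, hj, ht, rfl⟩ := (P.mem_left_iff (hY y hy)).1 hy
    obtain ⟨u, hu, h2⟩ := key' (show j < k by omega) ht
    exact (P'.mem_left_iff (hY _ hy)).2 ⟨j, u, hj, hu, h2⟩

/-- Pairs of sets of chips, of the same size, that change sides. -/
def exchanges (p q m : ℕ) : Finset (Finset ℕ × Finset ℕ) :=
  (range (p + 1)).biUnion fun i => powersetCard i (Ioo p (m * p)) ×ˢ
    powersetCard i (Ioo (m * p) (m * p + m * q - q))

theorem card_exchanges (p q m : ℕ) : (exchanges p q m).card =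
    ∑ i ∈ range (p + 1), (m * p - p - 1).choose i * (m * p + m * q - q - m * p - 1).choose i := by
  rw [exchanges, card_biUnion]
  · simp
  · intro i _ j _ hij
    refine disjoint_left.2 fun A hA hA' => hij ?_
    rw [mem_product, mem_powersetCard, mem_powersetCard] at hA hA'
    exact hA.1.2.symm.trans hA'.1.2

/-- The map from pairs `(X, Y)` with `k` stable configurations is injective: the result determines
`X` and `Y`, hence the chosen layout, and then the `k` configurations. -/
theorem card_exchanges_mul_le {k m : ℕ} (hk : 2 ≤ k) (hm : 3 ≤ m) :
    (exchanges (k / 2) (k - k / 2) m).card * (stableConfigs k m).ncard ^ k ≤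
      (stableConfigs k (k * m + 1)).ncard := by
  classical
  obtain ⟨w, rfl⟩ := Nat.exists_eq_add_of_le' (show 2 ≤ m by omega)
  have hex (A : exchanges (k / 2) (k - k / 2) (w + 2)) :
      ∃ (Λ : Layout k (w + 2) (k * (w + 2) + 1)) (P : Pattern (k / 2) (k - k / 2) w A.1.1 A.1.2),
        Λ.Central ∧ Λ.Reachable ∧ ∀ j t, (Λ.block j t : ℕ) = P.chip j t := by
    obtain ⟨i, hi, hA⟩ := mem_biUnion.1 A.2
    rw [mem_product] at hA
    rw [mem_range] at hi
    obtain ⟨P⟩ := nonempty_pattern (w := w) (by omega) (by omega) (by omega) (by omega) hA.1 hA.2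
    obtain ⟨Λ, h⟩ := P.exists_layout hk (by omega)
    exact ⟨Λ, P, h⟩
  choose Λ P h1 h2 h3 using hex
  have hbound (A : exchanges (k / 2) (k - k / 2) (w + 2)) :
      (∀ x ∈ A.1.1, x < (w + 2) * (k / 2)) ∧ ∀ y ∈ A.1.2, (w + 2) * (k / 2) < y := by
    obtain ⟨i, hi, hA⟩ := mem_biUnion.1 A.2
    rw [mem_product, mem_powersetCard, mem_powersetCard] at hA
    exact ⟨fun x hx => (mem_Ioo.1 (hA.1.1 hx)).2, fun y hy => (mem_Ioo.1 (hA.2.1 hy)).1⟩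
  have := (finite_stableConfigs k (w + 2)).fintype
  have := (finite_stableConfigs k (k * (w + 2) + 1)).fintype
  let f : exchanges (k / 2) (k - k / 2) (w + 2) × (Fin k → stableConfigs k (w + 2)) →
      stableConfigs k (k * (w + 2) + 1) := fun y =>
    ⟨(Λ y.1).combine fun j => (y.2 j : Config k (w + 2)),
      (Λ y.1).combine_mem_stableConfigs hk (h1 _) (h2 _) fun j => (y.2 j).2⟩
  have hf : Function.Injective f := by
    rintro ⟨A, c⟩ ⟨A', c'⟩ h
    have h : ((Λ A).combine fun j => (c j : Config k (w + 2))) =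
        (Λ A').combine fun j => (c' j : Config k (w + 2)) := congrArg Subtype.val h
    have h4 := (P A).subset_of_combine_eq (P A') (h3 A) (h3 A') h (hbound A).1 (hbound A).2
    have h5 := (P A').subset_of_combine_eq (P A) (h3 A') (h3 A) h.symm (hbound A').1 (hbound A').2
    obtain rfl : A = A' :=
      Subtype.ext (Prod.ext (h4.1.antisymm h5.1) (h4.2.antisymm h5.2))
    have h6 := (Λ A).combine_injective h
    congr 1
    ext1 j
    exact Subtype.ext (congrFun h6 j)
  have := Fintype.card_le_of_injective f hf
  rwa [Fintype.card_prod, Fintype.card_fun, Fintype.card_coe, Fintype.card_fin,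
    ← Nat.card_eq_fintype_card, ← Nat.card_eq_fintype_card (α := stableConfigs k (k * (w + 2) + 1)),
    Nat.card_coe_set_eq, Nat.card_coe_set_eq] at this

theorem sum_le_Z {k l : ℕ} (hk : 2 ≤ k) (hl : 3 ≤ l) :
    ∑ i ∈ range (k / 2 + 1), (lowerA k l).choose i * (lowerB k l + i).choose i * Z k (l - 1) ^ k ≤
      Z k l := by
  obtain ⟨m, rfl⟩ := Nat.exists_eq_add_of_le' (show 1 ≤ l by omega)
  have hM := lt_numChips hk (show 2 ≤ m by omega)
  have hq : k ⌈/⌉ 2 = k - k / 2 := by rw [Nat.ceilDiv_eq_add_pred_div]; omega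
  rw [Nat.add_sub_cancel, ← Finset.sum_mul]
  have hZ : Z k (m + 1) = (stableConfigs k (k * numChips k m + 1)).ncard := by
    rw [Z, numChips_succ hk]
  rw [hZ, Z]
  refine le_trans (Nat.mul_le_mul_right _ ?_) (card_exchanges_mul_le hk (by omega))
  rw [card_exchanges, lowerA, lowerB, numChips_succ hk, Nat.add_sub_cancel, hq, mul_assoc,
    Nat.mul_div_cancel_left _ (by omega), mul_assoc, Nat.mul_div_cancel_left _ (by omega)]
  -- This keeps the subtraction in `b` from truncating; `i ≤ p ≤ q` then gives `b + i ≤ m*q - q -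
  -- 1`.
  have h3 := Nat.mul_le_mul_right (k - k / 2) (show 3 ≤ numChips k m by omega)
  refine Finset.sum_le_sum fun i hi => Nat.mul_le_mul ?_ ?_
  · rw [Nat.sub_right_comm]
  · rw [Finset.mem_range] at hi
    exact Nat.choose_le_choose _ (by omega)

end ChipFiring

theorem mainTheorem5 (k l : ℕ) (hk : 2 ≤ k) (hl : 3 ≤ l) :
    ChipFiring.Z k l ≥
      ∑ i ∈ Finset.range (k / 2 + 1),
        (ChipFiring.lowerA k l).choose i * (ChipFiring.lowerB k l + i).choose i *
          ChipFiring.Z k (l - 1) ^ k :=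
  ChipFiring.sum_le_Z hk hl
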